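/- Let $p$ be an odd prime and let $e$ be a positive integer. Write $\phi$ for Euler's totient function and, for positive integers $n$ and $d$, let $N_{x^n-1}(d)$ be the number of residue classes $z \in \mathbb{Z}/d\mathbb{Z}$ with $z^n - 1 \equiv 0 \pmod d$. For every positive integer $n$ with $p \nmid n$, the number of integers $x$ with $1 \le x \le p^e(p-1)$, $p \nmid x$ and $$x^{x^n} \equiv x \pmod{p^e}$$ is $$\sum_{x_0=1}^{p-1} \gcd(p-1,\, x_0^n-1) \;+\; \sum_{x_0=1}^{p-1} \gcd(p-1,\, n,\, x_0^n-1)\left(p^{\lfloor e/2\rfloor}-1\right)$$ $$=\; \sum_{d \mid p-1} \phi(d)\,\frac{p-1}{d}\,N_{x^n-1}(d) \;+\; \sum_{d \mid \gcd(n,\,p-1)} \phi(d)\,\frac{p-1}{d}\,N_{x^n-1}(d)\left(p^{\lfloor e/2\rfloor}-1\right).$$ In particular, the number of integers $x$ with $1 \le x \le p^e(p-1)$, $p \nmid x$ and $x^x \equiv x \pmod{p^e}$ is $$\sum_{x_0=1}^{p-1} \gcd(p-1,\, x_0-1) + (p-1)\left(p^{\lfloor e/2\rfloor}-1\right) \;=\;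 \sum_{d \mid p-1} \phi(d)\,\frac{p-1}{d} + (p-1)\left(p^{\lfloor e/2\rfloor}-1\right).$$ (Here $\gcd(m,0)=m$.) -/

import Mathlib

/-- The number of fixed points of `x ↦ x ^ (x ^ n)` modulo `p ^ e`, among the integers `x`
with `1 ≤ x ≤ p ^ e * (p - 1)` and `p ∤ x`. -/
def selfPowerFixedPoints (p n e : ℕ) : ℕ :=
  ((Finset.Icc 1 (p ^ e * (p - 1))).filter
    (fun x => ¬ p ∣ x ∧ x ^ (x ^ n) ≡ x [MOD p ^ e])).card

/-- For an integer polynomial `g`, the number of residue classes `z` modulo `d` with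
`g(z) ≡ 0` modulo `d`. -/
noncomputable def numRootsMod (g : Polynomial ℤ) (d : ℕ) : ℕ :=
  Nat.card {z : ZMod d // Polynomial.aeval z g = 0}

/-!
An integer `x` prime to `p` satisfies `x ^ x ^ n ≡ x` modulo `p ^ e` exactly when its class `u` in
`(ZMod (p ^ e))ˣ` satisfies `u ^ (x ^ n - 1) = 1`. This unit group is cyclic of order
`(p - 1) * p ^ (e - 1)`, a product of coprime factors, so `u = a * b` uniquely with
`a ^ (p - 1) = 1` and `b ^ p ^ (e - 1) = 1`, and the condition must hold for `a` and `b` separately.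

For `a` it depends only on the class `x₀` of `x` modulo `p - 1`: it reads `a ^ (x₀ ^ n - 1) = 1`. For
`b` it is, by lifting the exponent, either `b = 1`, or `a ^ n = 1` together with `b ^ p ^ (e / 2) = 1`
(`pow_pow_sub_one_eq_one_iff`). Since `x₀`, `a` and `b` can be prescribed independently, by the
Chinese remainder theorem, the count for each `x₀` is a count of torsion elements in a cyclic
group (`card_fiber`), and these are gcds.

The second form of the count writes a gcd as the sum of `φ d` over its divisors `d` and exchanges the
order of summation; the condition `d ∣ x₀ ^ n - 1` is periodic in `x₀`, so it is met by
`(p - 1) / d` times as many `x₀` as `X ^ n - 1` has roots modulo `d` (`sum_gcd_pow_sub_one`).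
-/

/-! ### Powers of units congruent to `1` modulo `p` -/

/-- Lifting the exponent: for `z ≡ 1` modulo an odd prime `p`, whether `z ^ m = 1` modulo `p ^ e`
depends only on the orders of `z - 1` and of `m` at `p`. -/
theorem pow_eq_one_iff_emultiplicity {p : ℕ} (hp : p.Prime) (hp2 : p ≠ 2) {e : ℕ} {z : ℤ}
    (hz : (p : ℤ) ∣ z - 1) (m : ℕ) :
    (z : ZMod (p ^ e)) ^ m = 1 ↔
      (e : ℕ∞) ≤ emultiplicity (p : ℤ) (z - 1) + emultiplicity p m := by
  have hz' : ¬ (p : ℤ) ∣ z := fun h => by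
    have h1 : (p : ℤ) ∣ 1 := by simpa using dvd_sub h hz
    exact hp.one_lt.ne' (by exact_mod_cast Int.eq_one_of_dvd_one (by positivity) h1)
  have key := Int.emultiplicity_pow_sub_pow hp (hp.odd_of_ne_two hp2) hz hz' m
  rw [one_pow] at key
  rw [← key, ← pow_dvd_iff_le_emultiplicity]
  have := ZMod.intCast_zmod_eq_zero_iff_dvd (z ^ m - 1) (p ^ e)
  push_cast at this
  rw [← this, sub_eq_zero]

/-! ### Splitting a commutative group into coprime torsion parts -/

/-- Coprime torsion parts do not interact: if `a` and `b` have coprime orders, a power of `a * b`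
is trivial exactly when the same powers of `a` and of `b` are. -/
theorem mul_pow_eq_one_iff_of_coprime {G : Type*} [CommGroup G] {r s : ℕ} (hrs : r.Coprime s)
    {a b : G} (ha : a ^ r = 1) (hb : b ^ s = 1) (m : ℕ) :
    (a * b) ^ m = 1 ↔ a ^ m = 1 ∧ b ^ m = 1 := by
  have hco : (orderOf a).Coprime (orderOf b) :=
    Nat.Coprime.of_dvd (orderOf_dvd_of_pow_eq_one ha) (orderOf_dvd_of_pow_eq_one hb) hrs
  simp only [← orderOf_dvd_iff_pow_eq_one]
  rw [(Commute.all a b).orderOf_mul_eq_mul_orderOf_of_coprime hco]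
  exact ⟨fun h => ⟨dvd_of_mul_right_dvd h, dvd_of_mul_left_dvd h⟩,
    fun h => hco.mul_dvd_of_dvd_of_dvd h.1 h.2⟩

/-- An element of exponent `r * s` with `r`, `s` coprime is a product of an `r`-torsion and an
`s`-torsion element, by Bézout. -/
theorem exists_mul_eq_of_coprime {G : Type*} [CommGroup G] {r s : ℕ} (hrs : r.Coprime s)
    {u : G} (hu : u ^ (r * s) = 1) :
    ∃ a b : G, a ^ r = 1 ∧ b ^ s = 1 ∧ a * b = u := by
  have hu' : u ^ ((r : ℤ) * s) = 1 := by exact_mod_cast hu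
  refine ⟨u ^ ((s : ℤ) * r.gcdB s), u ^ ((r : ℤ) * r.gcdA s), ?_, ?_, ?_⟩
  · rw [← zpow_natCast, ← zpow_mul,
      show (s : ℤ) * r.gcdB s * r = (r * s) * r.gcdB s by ring, zpow_mul, hu', one_zpow]
  · rw [← zpow_natCast, ← zpow_mul,
      show (r : ℤ) * r.gcdA s * s = (r * s) * r.gcdA s by ring, zpow_mul, hu', one_zpow]
  · have h := Nat.gcd_eq_gcd_ab r s
    rw [hrs.gcd_eq_one] at h
    rw [← zpow_add, add_comm, ← h]
    simp

theorem mul_injective_of_coprime {G : Type*} [CommGroup G] {r s : ℕ} (hrs : r.Coprime s)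
    {a b a' b' : G} (ha : a ^ r = 1) (hb : b ^ s = 1) (ha' : a' ^ r = 1) (hb' : b' ^ s = 1)
    (h : a * b = a' * b') : a = a' ∧ b = b' := by
  have h1 : (a / a') * (b / b') = 1 := by rw [div_mul_div_comm, h, div_self']
  have h2 := (mul_pow_eq_one_iff_of_coprime hrs (a := a / a') (b := b / b')
    (by rw [div_pow, ha, ha', div_one]) (by rw [div_pow, hb, hb', div_one]) 1).1 (by simpa using h1)
  simpa [div_eq_one] using h2

/-! ### The fixed-point condition on the two torsion parts -/

/-- A unit modulo `p ^ e` of `p`-power order reduces to `1` modulo `p`, because raising to a power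
of `p` is the identity on `ZMod p`. -/
theorem prime_dvd_val_sub_one {p : ℕ} (hp : p.Prime) {e : ℕ} (he : 1 ≤ e) {k : ℕ}
    {b : (ZMod (p ^ e))ˣ} (hb : b ^ p ^ k = 1) :
    (p : ℤ) ∣ ((b : ZMod (p ^ e)).val : ℤ) - 1 := by
  have : Fact p.Prime := ⟨hp⟩
  have : NeZero (p ^ e) := ⟨(pow_pos hp.pos e).ne'⟩
  have hb' : (b : ZMod (p ^ e)) ^ p ^ k = 1 := by
    rw [← Units.val_pow_eq_pow_val, hb, Units.val_one]
  have h := congrArg (ZMod.castHom (dvd_pow_self p (by omega : e ≠ 0)) (ZMod p)) hb'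
  rw [map_pow, map_one, ZMod.pow_card_pow, ZMod.castHom_apply, ZMod.cast_eq_val] at h
  rw [← ZMod.intCast_zmod_eq_zero_iff_dvd]
  push_cast
  rw [h, sub_self]

/-- The kernel of reduction modulo `p` has no `(p - 1)`-torsion, as `p ∤ p - 1`. -/
theorem eq_one_of_pow_pred_eq_one {p : ℕ} (hp : p.Prime) (hp2 : p ≠ 2) {e : ℕ} {z : ℤ}
    (hz : (p : ℤ) ∣ z - 1) (h : (z : ZMod (p ^ e)) ^ (p - 1) = 1) : (z : ZMod (p ^ e)) = 1 := by
  have hp1 := hp.two_le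
  rw [pow_eq_one_iff_emultiplicity hp hp2 hz, (emultiplicity_eq_zero (a := p)).2, add_zero] at h
  · rw [← pow_one (z : ZMod (p ^ e)), pow_eq_one_iff_emultiplicity hp hp2 hz]
    exact h.trans le_self_add
  · exact Nat.not_dvd_of_pos_of_lt (by omega) (by omega)

/-- The condition on the `p`-primary part `b` of the unit `x = a * b`. If `b ≠ 1`, then
`b ^ (x ^ n - 1) = 1` forces `p ∣ x ^ n - 1`, hence `a ^ n = 1` and `x ^ n = b ^ n`. As `p ∤ n`, the
numbers `x ^ n - 1` and `b - 1` then have the same order `j` at `p`, and lifting the exponent turns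
the condition into `e ≤ 2 * j`, which says that the order of `b` divides `p ^ (e / 2)`. -/
theorem pow_pow_sub_one_eq_one_iff {p : ℕ} (hp : p.Prime) (hp2 : p ≠ 2) {e n : ℕ} (he : 1 ≤ e)
    (hn : ¬ p ∣ n) {a b : (ZMod (p ^ e))ˣ} (ha : a ^ (p - 1) = 1) (hb : b ^ p ^ (e - 1) = 1)
    {x : ℕ} (hx : 1 ≤ x) (hxab : (x : ZMod (p ^ e)) = a * b) :
    b ^ (x ^ n - 1) = 1 ↔ b = 1 ∨ (a ^ n = 1 ∧ b ^ p ^ (e / 2) = 1) := by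
  have : NeZero (p ^ e) := ⟨(pow_pos hp.pos e).ne'⟩
  have hpp : Prime (p : ℤ) := Nat.prime_iff_prime_int.1 hp
  set z : ℤ := ((b : ZMod (p ^ e)).val : ℤ) with hzdef
  have hz : (p : ℤ) ∣ z - 1 := prime_dvd_val_sub_one hp he hb
  have hzb : (z : ZMod (p ^ e)) = b := by simp [hzdef]
  have hpow (m : ℕ) : b ^ m = 1 ↔
      (e : ℕ∞) ≤ emultiplicity (p : ℤ) (z - 1) + emultiplicity p m := by
    rw [← pow_eq_one_iff_emultiplicity hp hp2 hz, hzb, ← Units.val_pow_eq_pow_val,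
      Units.val_eq_one]
  by_cases hb1 : b = 1
  · simp [hb1]
  have hJ : emultiplicity (p : ℤ) (z - 1) < e := by
    by_contra! h
    exact hb1 (by simpa using (hpow 1).2 (h.trans le_self_add))
  have hxn : 1 ≤ x ^ n := Nat.one_le_pow _ _ hx
  have hm : emultiplicity p (x ^ n - 1) = emultiplicity (p : ℤ) ((x : ℤ) ^ n - 1) := by
    rw [← Int.natCast_emultiplicity]
    push_cast [Nat.cast_sub hxn]
    rfl
  simp only [hb1, false_or]
  by_cases han : a ^ n = 1
  · have hdvd : (p : ℤ) ^ e ∣ (x : ℤ) ^ n - z ^ n := by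
      have h := ZMod.intCast_zmod_eq_zero_iff_dvd ((x : ℤ) ^ n - z ^ n) (p ^ e)
      push_cast at h
      rw [← h, hzb, hxab, mul_pow, ← Units.val_pow_eq_pow_val a, han]
      simp
    have hzn : emultiplicity (p : ℤ) (z ^ n - 1) = emultiplicity (p : ℤ) (z - 1) := by
      have hz' : ¬ (p : ℤ) ∣ z := fun h => hpp.not_dvd_one (by simpa using dvd_sub h hz)
      simpa using emultiplicity_pow_sub_pow_of_prime hpp hz hz'
        (n := n) (by exact_mod_cast hn)
    -- `x ^ n - 1` and `z - 1` are divisible by `p` to the same order, as this order is below `e`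
    have hmJ : emultiplicity p (x ^ n - 1) = emultiplicity (p : ℤ) (z - 1) := by
      rw [hm, ← hzn, ← sub_add_sub_cancel ((x : ℤ) ^ n) (z ^ n) 1]
      apply emultiplicity_add_of_gt
      rw [hzn]
      exact hJ.trans_le (pow_dvd_iff_le_emultiplicity.1 hdvd)
    rw [hpow, hpow, hmJ, emultiplicity_pow_self hp.ne_zero (Nat.prime_iff.1 hp).not_isUnit]
    obtain ⟨j, hj⟩ := ENat.ne_top_iff_exists.1 hJ.ne_top
    rw [← hj]
    simp only [han, true_and]
    norm_cast
    omega
  · simp only [han, false_and, iff_false]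
    intro h
    apply han
    have hpx : (p : ℤ) ∣ (x : ℤ) ^ n - 1 := by
      by_contra hnd
      rw [hpow, hm, emultiplicity_eq_zero.2 hnd, add_zero] at h
      exact absurd h hJ.not_ge
    set w : ℤ := (((a ^ n : (ZMod (p ^ e))ˣ) : ZMod (p ^ e)).val : ℤ) with hwdef
    have hwa : (w : ZMod (p ^ e)) = ((a ^ n : (ZMod (p ^ e))ˣ) : ZMod (p ^ e)) := by simp [hwdef]
    -- modulo `p`, `1 = x ^ n = a ^ n * z ^ n = a ^ n`
    have hwx : (p : ℤ) ∣ w * z ^ n - x ^ n := by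
      refine (dvd_pow_self (p : ℤ) (by omega : e ≠ 0)).trans ?_
      have h := ZMod.intCast_zmod_eq_zero_iff_dvd (w * z ^ n - (x : ℤ) ^ n) (p ^ e)
      push_cast at h
      rw [← h, hzb, hwa, hxab, mul_pow, Units.val_pow_eq_pow_val, sub_self]
    have hw : (p : ℤ) ∣ w - 1 := by
      have hzn : (p : ℤ) ∣ z ^ n - 1 := hz.trans (sub_one_dvd_pow_sub_one z n)
      rw [show w - 1 = w * z ^ n - x ^ n + (x ^ n - 1) - w * (z ^ n - 1) by ring]
      exact dvd_sub (dvd_add hwx hpx) (hzn.mul_left w)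
    have := eq_one_of_pow_pred_eq_one hp hp2 (e := e) hw
      (by rw [hwa, ← Units.val_pow_eq_pow_val, pow_right_comm, ha]; simp)
    rwa [hwa, Units.val_eq_one] at this

/-- The fixed-point condition for `x = a * b` depends only on the pair `(a, b)` of torsion units
and on the class `x₀` of `x` modulo `p - 1`. -/
theorem self_power_fixed_iff {p : ℕ} (hp : p.Prime) (hp2 : p ≠ 2) {e n : ℕ} (he : 1 ≤ e)
    (hn : ¬ p ∣ n) {a b : (ZMod (p ^ e))ˣ} (ha : a ^ (p - 1) = 1) (hb : b ^ p ^ (e - 1) = 1)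
    {x x₀ : ℕ} (hx : 1 ≤ x) (hx₀ : 1 ≤ x₀) (hxx₀ : x ≡ x₀ [MOD p - 1])
    (hxab : (x : ZMod (p ^ e)) = a * b) :
    x ^ x ^ n ≡ x [MOD p ^ e] ↔
      a ^ (x₀ ^ n - 1) = 1 ∧ (b = 1 ∨ (a ^ n = 1 ∧ b ^ p ^ (e / 2) = 1)) := by
  have hxn : 1 ≤ x ^ n := Nat.one_le_pow _ _ hx
  have hxn₀ : 1 ≤ x₀ ^ n := Nat.one_le_pow _ _ hx₀
  have hco : (p - 1).Coprime (p ^ (e - 1)) := by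
    apply Nat.Coprime.pow_right
    have := hp.one_lt
    rw [Nat.coprime_comm, hp.coprime_iff_not_dvd]
    exact Nat.not_dvd_of_pos_of_lt (by omega) (by omega)
  have hsub {u : (ZMod (p ^ e))ˣ} {k : ℕ} (hk : 1 ≤ k) : u ^ k = u ↔ u ^ (k - 1) = 1 := by
    conv_lhs => rw [← Nat.sub_add_cancel hk, pow_succ]
    exact mul_eq_right
  rw [← ZMod.natCast_eq_natCast_iff, Nat.cast_pow, hxab, ← Units.val_mul,
    ← Units.val_pow_eq_pow_val, Units.val_inj, hsub hxn, mul_pow_eq_one_iff_of_coprime hco ha hb,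
    pow_pow_sub_one_eq_one_iff hp hp2 he hn ha hb hx hxab, ← hsub hxn, ← hsub hxn₀]
  have : a ^ x ^ n = a ^ x₀ ^ n := pow_eq_pow_iff_modEq.2
    ((hxx₀.pow n).of_dvd (orderOf_dvd_of_pow_eq_one ha))
  rw [this]

/-! ### Counting pairs of torsion units -/

theorem IsCyclic.card_filter_pow_eq_one {G : Type*} [CommGroup G] [IsCyclic G] [Fintype G]
    [DecidableEq G] (d : ℕ) :
    (Finset.univ.filter (fun g : G => g ^ d = 1)).card = (Nat.card G).gcd d := by
  rw [← IsCyclic.card_powMonoidHom_ker, ← Nat.subtype_card]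
  intro g
  simp [MonoidHom.mem_ker]

theorem pow_eq_one_and_pow_eq_one_iff {G : Type*} [Group G] {g : G} {k l : ℕ} :
    g ^ k = 1 ∧ g ^ l = 1 ↔ g ^ k.gcd l = 1 := by
  simp only [← orderOf_dvd_iff_pow_eq_one, Nat.dvd_gcd_iff]

/-- The pairs with `b = 1` contribute the first gcd, and those with `b ≠ 1` the second term. -/
theorem card_torsion_pairs {p : ℕ} (hp : p.Prime) (hp2 : p ≠ 2) {e n m : ℕ} (he : 1 ≤ e)
    [Fintype (ZMod (p ^ e))ˣ] [DecidableEq (ZMod (p ^ e))ˣ] :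
    ((Finset.univ : Finset ((ZMod (p ^ e))ˣ × (ZMod (p ^ e))ˣ)).filter (fun c =>
      c.1 ^ (p - 1) = 1 ∧ c.2 ^ p ^ (e - 1) = 1 ∧
        c.1 ^ m = 1 ∧ (c.2 = 1 ∨ (c.1 ^ n = 1 ∧ c.2 ^ p ^ (e / 2) = 1)))).card
      = (p - 1).gcd m + (p - 1).gcd (n.gcd m) * (p ^ (e / 2) - 1) := by
  have := ZMod.isCyclic_units_of_prime_pow p hp hp2 e
  have hcard : Nat.card (ZMod (p ^ e))ˣ = p ^ (e - 1) * (p - 1) := by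
    have : NeZero (p ^ e) := ⟨(pow_pos hp.pos e).ne'⟩
    rw [Nat.card_eq_fintype_card, ZMod.card_units_eq_totient, Nat.totient_prime_pow hp he]
  have hA (k : ℕ) : (Finset.univ.filter (fun g : (ZMod (p ^ e))ˣ =>
      g ^ (p - 1) = 1 ∧ g ^ k = 1)).card = (p - 1).gcd k := by
    simp only [pow_eq_one_and_pow_eq_one_iff]
    rw [IsCyclic.card_filter_pow_eq_one, hcard]
    exact Nat.gcd_eq_right ((Nat.gcd_dvd_left _ _).mul_left _)
  have hle : p ^ (e / 2) ∣ p ^ (e - 1) := pow_dvd_pow p (by omega)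
  have hB : ((Finset.univ.filter (fun g : (ZMod (p ^ e))ˣ => g ^ p ^ (e / 2) = 1)).erase 1).card
      = p ^ (e / 2) - 1 := by
    rw [Finset.card_erase_of_mem (by simp), IsCyclic.card_filter_pow_eq_one, hcard,
      Nat.gcd_eq_right (hle.mul_right _)]
  have hone : (p - 1).gcd m = ((Finset.univ.filter (fun g : (ZMod (p ^ e))ˣ =>
      g ^ (p - 1) = 1 ∧ g ^ m = 1)) ×ˢ {1}).card (α := (ZMod (p ^ e))ˣ × (ZMod (p ^ e))ˣ) := by
    rw [Finset.card_product, hA, Finset.card_singleton, mul_one]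
  rw [hone, ← hA (n.gcd m), ← hB, ← Finset.card_product, ← Finset.card_union_of_disjoint]
  · congr 1
    ext ⟨a, b⟩
    have hb : b ^ p ^ (e / 2) = 1 → b ^ p ^ (e - 1) = 1 := by
      simp only [← orderOf_dvd_iff_pow_eq_one]
      exact fun h => h.trans hle
    simp only [Finset.mem_filter, Finset.mem_univ, true_and, Finset.mem_union, Finset.mem_product,
      Finset.mem_singleton, Finset.mem_erase, ← pow_eq_one_and_pow_eq_one_iff]
    by_cases h : b = 1
    · simp [h]
    · simp only [h]
      tauto
  · rw [Finset.disjoint_left]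
    rintro ⟨a, b⟩ h1 h2
    simp only [Finset.mem_product, Finset.mem_singleton, Finset.mem_erase] at h1 h2
    exact h2.2.1 h1.2

/-! ### Counting the fixed points -/

theorem Nat.exists_mem_Icc_modEq {N : ℕ} (hN : 0 < N) (x : ℕ) :
    ∃ r ∈ Finset.Icc 1 N, x ≡ r [MOD N] := by
  by_cases h : x % N = 0
  · exact ⟨N, by simp; omega, by rw [Nat.ModEq, h, Nat.mod_self]⟩
  · have := Nat.mod_lt x hN
    exact ⟨x % N, by simp only [Finset.mem_Icc]; omega, (Nat.mod_modEq x N).symm⟩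

/-- The fixed points in a given class modulo `p - 1` correspond, by the Chinese remainder theorem
for the coprime moduli `p ^ e` and `p - 1`, to the pairs of torsion units counted by
`card_torsion_pairs`. -/
theorem card_fiber {p : ℕ} (hp : p.Prime) (hp2 : p ≠ 2) {e n x₀ : ℕ} (he : 1 ≤ e)
    (hn : ¬ p ∣ n) (hx₀ : 1 ≤ x₀) :
    ((Finset.Icc 1 (p ^ e * (p - 1))).filter (fun x =>
        (¬ p ∣ x ∧ x ^ (x ^ n) ≡ x [MOD p ^ e]) ∧ x ≡ x₀ [MOD p - 1])).card
      = (p - 1).gcd (x₀ ^ n - 1)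
        + (p - 1).gcd (n.gcd (x₀ ^ n - 1)) * (p ^ (e / 2) - 1) := by
  classical
  have : NeZero (p ^ e) := ⟨(pow_pos hp.pos e).ne'⟩
  have hp1 := hp.one_lt
  have hco₁ : p.Coprime (p - 1) := by
    rw [hp.coprime_iff_not_dvd]
    exact Nat.not_dvd_of_pos_of_lt (by omega) (by omega)
  have hco : (p ^ e).Coprime (p - 1) := hco₁.pow_left e
  have hco' : (p - 1).Coprime (p ^ (e - 1)) := (hco₁.pow_left _).symm
  have hM : 0 < p ^ e * (p - 1) := by
    have := pow_pos hp.pos e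
    exact Nat.mul_pos this (by omega)
  have hdvd (x : ℕ) : x.Coprime (p ^ e) ↔ ¬ p ∣ x := by
    rw [Nat.coprime_pow_right_iff he, Nat.coprime_comm, hp.coprime_iff_not_dvd]
  have hrep (v : ZMod (p ^ e)) : ∃ x ∈ Finset.Icc 1 (p ^ e * (p - 1)),
      (x : ZMod (p ^ e)) = v ∧ x ≡ x₀ [MOD p - 1] := by
    obtain ⟨k, hk1, hk2⟩ := Nat.chineseRemainder hco v.val x₀
    have hk1' : (k : ZMod (p ^ e)) = v := by
      rw [(ZMod.natCast_eq_natCast_iff _ _ _).2 hk1, ZMod.natCast_zmod_val]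
    obtain ⟨x, hxI, hx⟩ := Nat.exists_mem_Icc_modEq hM k
    refine ⟨x, hxI, ?_, (hx.of_mul_left _).symm.trans hk2⟩
    rw [← hk1']
    exact (ZMod.natCast_eq_natCast_iff _ _ _).2 (hx.of_mul_right _).symm
  choose f hfI hfv hfx using hrep
  rw [← card_torsion_pairs hp hp2 he]
  symm
  refine Finset.card_bij (fun c _ => f (c.1 * c.2 : (ZMod (p ^ e))ˣ)) ?_ ?_ ?_
  · rintro ⟨a, b⟩ hc
    simp only [Finset.mem_filter, Finset.mem_univ, true_and] at hc ⊢
    obtain ⟨ha, hb, hab⟩ := hc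
    refine ⟨hfI _, ⟨?_, ?_⟩, hfx _⟩
    · rw [← hdvd, ← ZMod.isUnit_iff_coprime, hfv]
      exact Units.isUnit _
    · exact (self_power_fixed_iff hp hp2 he hn ha hb (Finset.mem_Icc.1 (hfI _)).1 hx₀ (hfx _)
        (by rw [hfv, Units.val_mul])).2 hab
  · rintro ⟨a, b⟩ hc ⟨a', b'⟩ hc' h
    simp only [Finset.mem_filter, Finset.mem_univ, true_and] at hc hc' h
    have h' := congrArg (Nat.cast (R := ZMod (p ^ e))) h
    rw [hfv, hfv, Units.val_inj] at h'
    obtain ⟨h1, h2⟩ := mul_injective_of_coprime hco' hc.1 hc.2.1 hc'.1 hc'.2.1 h'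
    rw [h1, h2]
  · intro x hx
    simp only [Finset.mem_filter] at hx
    obtain ⟨hxI, ⟨hpx, hfix⟩, hxx₀⟩ := hx
    obtain ⟨u, hu⟩ := (ZMod.isUnit_iff_coprime x (p ^ e)).2 ((hdvd x).2 hpx)
    obtain ⟨a, b, ha, hb, hab⟩ := exists_mul_eq_of_coprime hco' (u := u) (by
      rw [mul_comm, ← Nat.totient_prime_pow hp he]
      exact ZMod.pow_totient u)
    have hxab : (x : ZMod (p ^ e)) = a * b := by rw [← hu, ← hab, Units.val_mul]
    refine ⟨(a, b), ?_, ?_⟩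
    · simp only [Finset.mem_filter, Finset.mem_univ, true_and]
      exact ⟨ha, hb, (self_power_fixed_iff hp hp2 he hn ha hb (Finset.mem_Icc.1 hxI).1 hx₀ hxx₀
        hxab).1 hfix⟩
    · have hmod : f ((a * b : (ZMod (p ^ e))ˣ) : ZMod (p ^ e)) ≡ x [MOD p ^ e * (p - 1)] := by
        rw [← Nat.modEq_and_modEq_iff_modEq_mul hco]
        refine ⟨?_, (hfx _).trans hxx₀.symm⟩
        rw [← ZMod.natCast_eq_natCast_iff, hfv, hxab, Units.val_mul]
      have h1 := Finset.mem_Icc.1 (hfI ((a * b : (ZMod (p ^ e))ˣ) : ZMod (p ^ e)))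
      have h2 := Finset.mem_Icc.1 hxI
      refine hmod.eq_of_abs_lt ?_
      rw [abs_lt]
      omega

theorem selfPowerFixedPoints_eq {p : ℕ} (hp : p.Prime) (hp2 : p ≠ 2) {e n : ℕ} (he : 1 ≤ e)
    (hn : ¬ p ∣ n) :
    selfPowerFixedPoints p n e
      = (∑ x₀ ∈ Finset.Icc 1 (p - 1), Nat.gcd (p - 1) (x₀ ^ n - 1))
        + ∑ x₀ ∈ Finset.Icc 1 (p - 1),
            Nat.gcd (p - 1) (Nat.gcd n (x₀ ^ n - 1)) * (p ^ (e / 2) - 1) := by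
  have hp1 := hp.one_lt
  choose r hrI hr using Nat.exists_mem_Icc_modEq (N := p - 1) (by omega)
  rw [selfPowerFixedPoints, ← Finset.sum_add_distrib,
    Finset.card_eq_sum_card_fiberwise (f := r) (t := Finset.Icc 1 (p - 1)) (fun x _ => hrI x)]
  refine Finset.sum_congr rfl fun x₀ hx₀ => ?_
  rw [← card_fiber hp hp2 he hn (Finset.mem_Icc.1 hx₀).1, Finset.filter_filter]
  congr 1
  refine Finset.filter_congr fun x _ => and_congr_right fun _ => ⟨fun h => h ▸ hr x, fun h => ?_⟩
  have h1 := Finset.mem_Icc.1 hx₀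
  have h2 := Finset.mem_Icc.1 (hrI x)
  refine ((hr x).symm.trans h).eq_of_abs_lt ?_
  rw [abs_lt]
  omega

/-! ### Gcd sums as sums over divisors -/

theorem card_filter_Icc_mul (d q : ℕ) (P : ℕ → Prop) [DecidablePred P]
    (hP : Function.Periodic P d) :
    ((Finset.Icc 1 (d * q)).filter P).card = q * d.count P := by
  suffices ((Finset.Ico 1 (1 + d * q)).filter P).card = q * d.count P by
    rwa [add_comm, Finset.Ico_add_one_right_eq_Icc] at this
  induction q with
  | zero => simp
  | succ q ih =>
    rw [← Finset.Ico_union_Ico_eq_Ico (b := 1 + d * q) (by omega)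
      (by rw [mul_add, mul_one]; omega), Finset.filter_union, Finset.card_union_of_disjoint, ih,
      show 1 + d * (q + 1) = 1 + d * q + d by ring, Nat.filter_Ico_card_eq_of_periodic _ d P hP]
    · ring
    · exact Finset.disjoint_filter_filter (Finset.Ico_disjoint_Ico_consecutive _ _ _)

theorem numRootsMod_X_pow_sub_one (n : ℕ) {d : ℕ} (hd : 0 < d) :
    numRootsMod (Polynomial.X ^ n - 1) d
      = d.count (fun x => ((x : ZMod d) ^ n = 1)) := by
  have : NeZero d := ⟨hd.ne'⟩
  rw [numRootsMod, Nat.count_eq_card_filter_range,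
    Nat.subtype_card (((Finset.range d).filter (fun x : ℕ => ((x : ZMod d) ^ n = 1))).image
      (Nat.cast (R := ZMod d)))]
  · refine Finset.card_image_of_injOn fun x hx y hy h => ?_
    simp only [Finset.coe_filter, Finset.mem_range, Set.mem_ofPred_eq] at hx hy
    exact ((ZMod.natCast_eq_natCast_iff _ _ _).1 h).eq_of_lt_of_lt hx.1 hy.1
  · intro z
    simp only [Finset.mem_image, Finset.mem_filter, Finset.mem_range, map_sub, map_pow,
      Polynomial.aeval_X, map_one, sub_eq_zero]
    constructor
    · rintro ⟨x, ⟨-, hx⟩, rfl⟩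
      exact hx
    · exact fun hz => ⟨z.val, ⟨z.val_lt, by rwa [ZMod.natCast_zmod_val]⟩, ZMod.natCast_zmod_val z⟩

theorem card_filter_dvd_pow_sub_one (n : ℕ) {N d : ℕ} (hN : 0 < N) (hd : d ∣ N) :
    ((Finset.Icc 1 N).filter (fun x => d ∣ x ^ n - 1)).card
      = N / d * numRootsMod (Polynomial.X ^ n - 1) d := by
  have hd0 : 0 < d := Nat.pos_of_dvd_of_pos hd hN
  rw [numRootsMod_X_pow_sub_one n hd0, ← card_filter_Icc_mul d (N / d)
    (fun x => ((x : ZMod d) ^ n = 1)) (fun x => by simp), Nat.mul_div_cancel' hd]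
  congr 1
  refine Finset.filter_congr fun x hx => ?_
  have hx1 : 1 ≤ x ^ n := Nat.one_le_pow _ _ (Finset.mem_Icc.1 hx).1
  rw [← ZMod.natCast_eq_zero_iff, Nat.cast_sub hx1, Nat.cast_pow, Nat.cast_one, sub_eq_zero]

/-- The gcd is expanded by `∑ d ∣ m, φ d = m`, and the sums are exchanged. -/
theorem sum_gcd_pow_sub_one (n : ℕ) {N g : ℕ} (hN : 0 < N) (hg : g ∣ N) :
    ∑ x ∈ Finset.Icc 1 N, g.gcd (x ^ n - 1)
      = ∑ d ∈ g.divisors, Nat.totient d * (N / d) * numRootsMod (Polynomial.X ^ n - 1) d := by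
  have hg0 : g ≠ 0 := (Nat.pos_of_dvd_of_pos hg hN).ne'
  have hgcd (m : ℕ) : g.gcd m = ∑ d ∈ g.divisors, if d ∣ m then Nat.totient d else 0 := by
    rw [← Finset.sum_filter]
    conv_lhs => rw [← Nat.sum_totient (g.gcd m)]
    refine Finset.sum_congr ?_ fun _ _ => rfl
    ext d
    simp [Nat.dvd_gcd_iff, hg0]
  simp only [hgcd]
  rw [Finset.sum_comm]
  refine Finset.sum_congr rfl fun d hd => ?_
  rw [← Finset.sum_filter, Finset.sum_const, smul_eq_mul,
    card_filter_dvd_pow_sub_one n hN ((Nat.dvd_of_mem_divisors hd).trans hg)]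
  ring

theorem numRootsMod_X_pow_one_sub_one {d : ℕ} : numRootsMod (Polynomial.X ^ 1 - 1) d = 1 := by
  rw [numRootsMod, Nat.card_eq_one_iff_unique]
  refine ⟨⟨fun a b => Subtype.ext ?_⟩, ⟨⟨1, by simp⟩⟩⟩
  have ha := a.2
  have hb := b.2
  simp only [pow_one, map_sub, Polynomial.aeval_X, map_one, sub_eq_zero] at ha hb
  rw [ha, hb]

/- All subtractions are exact: `1 ≤ x₀`, `2 ≤ p`, and powers of `p` are positive. All divisions
`(p - 1) / d` are exact, since `d ∣ p - 1`; the division `e / 2` is the floor. -/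
theorem theorem3p6 (p : ℕ) (hp : p.Prime) (hp2 : p ≠ 2) (e : ℕ) (he : 1 ≤ e) :
    (∀ n : ℕ, ¬ p ∣ n →
      selfPowerFixedPoints p n e
          = (∑ x₀ ∈ Finset.Icc 1 (p - 1), Nat.gcd (p - 1) (x₀ ^ n - 1))
            + ∑ x₀ ∈ Finset.Icc 1 (p - 1),
                Nat.gcd (p - 1) (Nat.gcd n (x₀ ^ n - 1)) * (p ^ (e / 2) - 1)
      ∧ (∑ x₀ ∈ Finset.Icc 1 (p - 1), Nat.gcd (p - 1) (x₀ ^ n - 1))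
            + (∑ x₀ ∈ Finset.Icc 1 (p - 1),
                Nat.gcd (p - 1) (Nat.gcd n (x₀ ^ n - 1)) * (p ^ (e / 2) - 1))
          = (∑ d ∈ (p - 1).divisors,
                Nat.totient d * ((p - 1) / d)
                  * numRootsMod (Polynomial.X ^ n - 1) d)
            + ∑ d ∈ (Nat.gcd n (p - 1)).divisors,
                Nat.totient d * ((p - 1) / d)
                  * numRootsMod (Polynomial.X ^ n - 1) d * (p ^ (e / 2) - 1)) ∧
    (((Finset.Icc 1 (p ^ e * (p - 1))).filter
          (fun x => ¬ p ∣ x ∧ x ^ x ≡ x [MOD p ^ e])).card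
        = (∑ x₀ ∈ Finset.Icc 1 (p - 1), Nat.gcd (p - 1) (x₀ - 1))
          + (p - 1) * (p ^ (e / 2) - 1)
      ∧ (∑ x₀ ∈ Finset.Icc 1 (p - 1), Nat.gcd (p - 1) (x₀ - 1))
          + (p - 1) * (p ^ (e / 2) - 1)
        = (∑ d ∈ (p - 1).divisors, Nat.totient d * ((p - 1) / d))
          + (p - 1) * (p ^ (e / 2) - 1)) := by
  have hp1 := hp.one_lt
  have hN : 0 < p - 1 := by omega
  have hsum (n : ℕ) : (∑ x₀ ∈ Finset.Icc 1 (p - 1), Nat.gcd (p - 1) (Nat.gcd n (x₀ ^ n - 1)))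
      = ∑ d ∈ (Nat.gcd n (p - 1)).divisors,
          Nat.totient d * ((p - 1) / d) * numRootsMod (Polynomial.X ^ n - 1) d := by
    rw [← sum_gcd_pow_sub_one n hN (Nat.gcd_dvd_right n (p - 1))]
    exact Finset.sum_congr rfl fun x _ => by rw [← Nat.gcd_assoc, Nat.gcd_comm (p - 1) n]
  refine ⟨fun n hn => ⟨selfPowerFixedPoints_eq hp hp2 he hn, ?_⟩, ?_, ?_⟩
  · rw [sum_gcd_pow_sub_one n hN dvd_rfl, ← Finset.sum_mul, ← Finset.sum_mul, hsum]
  · have h := selfPowerFixedPoints_eq hp hp2 he (n := 1) hp.not_dvd_one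
    simpa [selfPowerFixedPoints] using h
  · have h := sum_gcd_pow_sub_one 1 hN (dvd_refl (p - 1))
    simp only [numRootsMod_X_pow_one_sub_one, mul_one] at h
    simp only [pow_one] at h
    rw [h]
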